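/- **Conventions.** Manifolds are smooth, Hausdorff, second countable and without boundary; metrics, connections and vector fields are smooth. A *statistical manifold* $(M,\nabla,g)$ is a manifold $M$ with a Riemannian metric $g$ and a torsion-free affine connection $\nabla$ such that $(\nabla_Xg)(Y,Z)=(\nabla_Yg)(X,Z)$ for all vector fields $X,Y,Z$. It is *trivial* (or *Riemannian*) if $\nabla$ is the Levi-Civita connection of $g$. It is *of constant curvature* $k\in\mathbb R$ if the curvature tensor $R$ of $\nabla$ satisfies $R(X,Y)Z=k\{g(Y,Z)X-g(X,Z)Y\}$ for all $X,Y,Z$. An immersion $f:(M,\nabla,g)\to(\tilde M,\tilde\nabla,\tilde g)$ between statistical manifolds is *statistical* if $g=f^*\tilde g$ and $g(\nabla_XY,Z)=\tilde g(\tilde\nabla_Xf_*Y,f_*Z)$ for all vector fields $X,Y,Z$ on $M$. If $f$ has codimension one and $\xi$ is a (locally defined) unit normal vector field of $f$, the one-form $\tau^*$ is defined by the Weingarten formula $\tilde\nabla_X\xi=-f_*A^*X+\tau^*(X)\xi$, where $A^*$ is a $(1,1)$-tensor field; $\tau^*$ does not change when $\xi$ is replaced by $-\xi$. **Theorem 4.1.**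 Let $n\ge 2$. Let $(M,\nabla,g)$ be an $n$-dimensional trivial statistical manifold of constant curvature $k$. Let $(\tilde M,\tilde\nabla,\tilde g)$ be an $(n+1)$-dimensional statistical manifold of constant curvature $\tilde k$ such that the Levi-Civita connection $\tilde\nabla^{\circ}$ of $\tilde g$ has constant curvature $\tilde k^{\circ}\neq\tilde k$. Then every statistical immersion $f:(M,\nabla,g)\to(\tilde M,\tilde\nabla,\tilde g)$ is equiaffine, that is, $\tau^*=0$. -/

import Mathlib

open Bundle
open scoped Manifold ContDiff

noncomputable section

section Connections

variable {E : Type*} [NormedAddCommGroup E] [NormedSpace ℝ E]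
  {M : Type*} [TopologicalSpace M] [ChartedSpace E M] [IsManifold 𝓘(ℝ, E) ∞ M]

/-- An affine connection on `M`, i.e. a covariant derivative on `TM`; `cov Y p (X p)` is the value
at `p` of `∇_X Y`. -/
abbrev AffineConnection (E : Type*) [NormedAddCommGroup E] [NormedSpace ℝ E]
    (M : Type*) [TopologicalSpace M] [ChartedSpace E M] [IsManifold 𝓘(ℝ, E) ∞ M] :=
  CovariantDerivative 𝓘(ℝ, E) E (TangentSpace 𝓘(ℝ, E) : M → Type _)

/-- A smooth Riemannian metric on `M`. -/
abbrev SmoothMetric (E : Type*) [NormedAddCommGroup E] [NormedSpace ℝ E]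
    (M : Type*) [TopologicalSpace M] [ChartedSpace E M] [IsManifold 𝓘(ℝ, E) ∞ M] :=
  ContMDiffRiemannianMetric 𝓘(ℝ, E) ∞ E (TangentSpace 𝓘(ℝ, E) : M → Type _)

/-- The curvature `R(X, Y) Z = ∇_X ∇_Y Z - ∇_Y ∇_X Z - ∇_{[X, Y]} Z` of an affine connection. -/
def affineCurvature (cov : AffineConnection E M)
    (X Y Z : Π p : M, TangentSpace 𝓘(ℝ, E) p) (p : M) : TangentSpace 𝓘(ℝ, E) p :=
  cov (fun q ↦ cov Z q (Y q)) p (X p) - cov (fun q ↦ cov Z q (X q)) p (Y p)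
    - cov Z p (VectorField.mlieBracket 𝓘(ℝ, E) X Y p)

/-- `(∇, g)` has constant curvature `k`: `R(X, Y) Z = k (g(Y, Z) X - g(X, Z) Y)` for all smooth
vector fields. -/
def HasConstantCurvature (cov : AffineConnection E M) (g : SmoothMetric E M) (k : ℝ) : Prop :=
  ∀ X Y Z : Π p : M, TangentSpace 𝓘(ℝ, E) p,
    CMDiff ∞ (T% X) → CMDiff ∞ (T% Y) → CMDiff ∞ (T% Z) → ∀ p : M,
      affineCurvature cov X Y Z p
        = k • (g.inner p (Y p) (Z p) • X p - g.inner p (X p) (Z p) • Y p)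

/-- `(∇_X g)(Y, Z) = X g(Y, Z) - g(∇_X Y, Z) - g(Y, ∇_X Z)`. -/
def covDerivMetric (cov : AffineConnection E M) (g : SmoothMetric E M)
    (X Y Z : Π p : M, TangentSpace 𝓘(ℝ, E) p) (p : M) : ℝ :=
  mvfderiv 𝓘(ℝ, E) (fun q ↦ g.inner q (Y q) (Z q)) p (X p)
    - g.inner p (cov Y p (X p)) (Z p) - g.inner p (Y p) (cov Z p (X p))

variable [FiniteDimensional ℝ E]

/-- `(∇, g)` is a statistical structure: `∇` is a smooth torsion-free affine connection with
`(∇_X g)(Y, Z) = (∇_Y g)(X, Z)`. -/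
structure IsStatisticalStructure (cov : AffineConnection E M) (g : SmoothMetric E M) : Prop where
  smooth : cov.ContMDiffCovariantDerivative ∞
  torsion_eq_zero : cov.torsion = 0
  codazzi : ∀ X Y Z : Π p : M, TangentSpace 𝓘(ℝ, E) p,
    CMDiff ∞ (T% X) → CMDiff ∞ (T% Y) → CMDiff ∞ (T% Z) → ∀ p : M,
      covDerivMetric cov g X Y Z p = covDerivMetric cov g Y X Z p

/-- `∇` is the Levi-Civita connection of `g`. The pair `(∇, g)` is then called a trivial
(or Riemannian) statistical structure. -/
structure IsLeviCivita (cov : AffineConnection E M) (g : SmoothMetric E M) : Prop where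
  smooth : cov.ContMDiffCovariantDerivative ∞
  torsion_eq_zero : cov.torsion = 0
  metric : ∀ X Y Z : Π p : M, TangentSpace 𝓘(ℝ, E) p,
    CMDiff ∞ (T% X) → CMDiff ∞ (T% Y) → CMDiff ∞ (T% Z) → ∀ p : M,
      covDerivMetric cov g X Y Z p = 0

end Connections

section Immersions

variable {E : Type*} [NormedAddCommGroup E] [NormedSpace ℝ E]
  {M : Type*} [TopologicalSpace M] [ChartedSpace E M]
  {E' : Type*} [NormedAddCommGroup E'] [NormedSpace ℝ E']
  {M' : Type*} [TopologicalSpace M'] [ChartedSpace E' M'] [IsManifold 𝓘(ℝ, E') ∞ M']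

/-- The covariant derivative `v ↦ ∇̃_v V` at `p` of a vector field `V` along `f : M → M'`, that is,
the connection that `∇̃` induces on the pullback bundle `f^* TM'`.  With respect to the standard
local frame `e` of `TM'` around `f p` it is given by
`∇̃_v (∑ V^i e_i ∘ f) = ∑ dV^i(v) e_i + ∑ V^i ∇̃_{df v} e_i`; here
`FiberBundle.extend E' (V p)` is the field `∑ V^i(p) e_i`. -/
def covDerivAlong (cov' : AffineConnection E' M') (f : M → M')
    (V : Π p : M, TangentSpace 𝓘(ℝ, E') (f p)) (p : M) :
    TangentSpace 𝓘(ℝ, E) p →L[ℝ] TangentSpace 𝓘(ℝ, E') (f p) :=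
  letI e := trivializationAt E' (TangentSpace 𝓘(ℝ, E') : M' → Type _) (f p)
  (e.symmL ℝ (f p)) ∘L (mvfderiv 𝓘(ℝ, E) (fun q ↦ (e ⟨f q, V q⟩).2) p)
    + (cov' (FiberBundle.extend E' (V p)) (f p)) ∘L (mfderiv 𝓘(ℝ, E) 𝓘(ℝ, E') f p)

/-- `ξ` is a smooth unit normal vector field of `f` on the set `U ⊆ M` (its values outside `U` are
irrelevant). -/
structure IsUnitNormalOn (g' : SmoothMetric E' M') (f : M → M') (U : Set M)
    (ξ : Π p : M, TangentSpace 𝓘(ℝ, E') (f p)) : Prop where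
  smooth : ContMDiffOn 𝓘(ℝ, E) (𝓘(ℝ, E').tangent) ∞
    (fun p ↦ (⟨f p, ξ p⟩ : TangentBundle 𝓘(ℝ, E') M')) U
  unit : ∀ p ∈ U, g'.inner (f p) (ξ p) (ξ p) = 1
  normal : ∀ p ∈ U, ∀ v : TangentSpace 𝓘(ℝ, E) p,
    g'.inner (f p) (ξ p) (mfderiv 𝓘(ℝ, E) 𝓘(ℝ, E') f p v) = 0

/-- The one-form `τ^*` of the Weingarten formula `∇̃_X ξ = -f_* A^* X + τ^*(X) ξ`: since `ξ` is a unit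
normal, it is `τ^*(X) = g̃(ξ, ∇̃_X ξ)`, see `weingartenForm_eq`. -/
def weingartenForm (cov' : AffineConnection E' M') (g' : SmoothMetric E' M') (f : M → M')
    (ξ : Π p : M, TangentSpace 𝓘(ℝ, E') (f p)) (p : M) : TangentSpace 𝓘(ℝ, E) p →L[ℝ] ℝ :=
  (g'.inner (f p) (ξ p)) ∘L (covDerivAlong cov' f ξ p)

/-- `weingartenForm` is the normal coefficient in the Weingarten formula. -/
theorem weingartenForm_eq {cov' : AffineConnection E' M'} {g' : SmoothMetric E' M'} {f : M → M'}
    {U : Set M} {ξ : Π p : M, TangentSpace 𝓘(ℝ, E') (f p)}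
    (hξ : IsUnitNormalOn (E := E) g' f U ξ) {p : M} (hp : p ∈ U) {v a : TangentSpace 𝓘(ℝ, E) p}
    {t : ℝ}
    (h : covDerivAlong cov' f ξ p v = -(mfderiv 𝓘(ℝ, E) 𝓘(ℝ, E') f p a) + t • ξ p) :
    weingartenForm cov' g' f ξ p v = t := by
  simp [weingartenForm, h, hξ.unit p hp, hξ.normal p hp]

/-- `f` is equiaffine: `τ^*` vanishes. As a unit normal field need only exist locally, and `τ^*` does
not change when `ξ` is replaced by `-ξ`, all local unit normal fields are taken into account. -/
def IsEquiaffine (cov' : AffineConnection E' M') (g' : SmoothMetric E' M') (f : M → M') : Prop :=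
  ∀ (U : Set M) (ξ : Π p : M, TangentSpace 𝓘(ℝ, E') (f p)), IsOpen U →
    IsUnitNormalOn (E := E) g' f U ξ → ∀ p ∈ U, weingartenForm (E := E) cov' g' f ξ p = 0

variable [IsManifold 𝓘(ℝ, E) ∞ M]

/-- `f : (M, ∇, g) → (M', ∇̃, g̃)` is a statistical immersion: an immersion such that `(∇, g)` is the
structure induced by `f`, that is `g = f^* g̃` and `g(∇_X Y, Z) = g̃(∇̃_X f_* Y, f_* Z)`. -/
structure IsStatisticalImmersion (cov : AffineConnection E M) (g : SmoothMetric E M)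
    (cov' : AffineConnection E' M') (g' : SmoothMetric E' M') (f : M → M') : Prop where
  immersion : Manifold.IsImmersion 𝓘(ℝ, E) 𝓘(ℝ, E') ∞ f
  metric_eq : ∀ (p : M) (u v : TangentSpace 𝓘(ℝ, E) p),
    g.inner p u v
      = g'.inner (f p) (mfderiv 𝓘(ℝ, E) 𝓘(ℝ, E') f p u) (mfderiv 𝓘(ℝ, E) 𝓘(ℝ, E') f p v)
  connection_eq : ∀ X Y Z : Π p : M, TangentSpace 𝓘(ℝ, E) p,
    CMDiff ∞ (T% X) → CMDiff ∞ (T% Y) → CMDiff ∞ (T% Z) → ∀ p : M,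
      g.inner p (cov Y p (X p)) (Z p)
        = g'.inner (f p)
            (covDerivAlong cov' f (fun q ↦ mfderiv 𝓘(ℝ, E) 𝓘(ℝ, E') f q (Y q)) p (X p))
            (mfderiv 𝓘(ℝ, E) 𝓘(ℝ, E') f p (Z p))

end Immersions

end

/-!
Write `K = ∇̃ - ∇̃°` for the difference tensor. The proof is pointwise once three facts about `K` are
known.

* The cubic form `g̃(K_X Y, Z)` is totally symmetric, by torsion-freeness and the Codazzi equation
  (`difference_symm`, `inner_difference_comm`). The difference of the two curvature tensors is
  `(∇̃°_X K)_Y - (∇̃°_Y K)_X + [K_X, K_Y]`, and comparing skew-adjoint parts gives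
  `[K_X, K_Y] Z = (k̃ - k̃°) (g̃(Y, Z) X - g̃(X, Z) Y)` (`inner_difference_bracket`).
* The connection induced along `f` by `∇̃°` is metric (`mvfderiv_inner_along`). As `∇` is metric too,
  `g̃(K_{f_* X} f_* Y, f_* Z)` is antisymmetric in `Y` and `Z`, and being symmetric it vanishes
  (`inner_difference_mfderiv_eq_zero`). Hence `K_X Y = h(X, Y) ξ` on tangent vectors.
* Since `∇̃°_X ξ` is tangential, `τ^*(X) = g̃(ξ, K_X ξ)` (`weingartenForm_eq_inner_difference`).

Pairing the commutator formula with `ξ` gives `h(Y, Z) τ^*(X) = h(X, Z) τ^*(Y)`. If `τ^*(X) ≠ 0`, then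
`h(Y, Z) h(X, W) - h(X, Z) h(Y, W) = 0` for all `Y, Z, W`, whereas the commutator formula paired with
tangent vectors evaluates this to `(k̃ - k̃°) (g̃(Y, Z) g̃(X, W) - g̃(X, Z) g̃(Y, W))`, which is non-zero for
`Z = Y` orthogonal to `X = W` (`normal_component_eq_zero`).
-/

noncomputable section

open Filter Topology

/-! ### Smooth vector fields with prescribed germ or value -/

section VectorFields

variable {E : Type*} [NormedAddCommGroup E] [NormedSpace ℝ E] [FiniteDimensional ℝ E]
  {M : Type*} [TopologicalSpace M] [T2Space M] [ChartedSpace E M] [IsManifold 𝓘(ℝ, E) ∞ M]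

/-- A tangent vector extends to a globally smooth vector field agreeing near the base point with the
local extension `FiberBundle.extend`: cut the latter off with a bump function. The hypotheses on
connections and metrics are about global smooth fields, and this makes them available locally. -/
theorem exists_smooth_vectorField_eventuallyEq_extend {p : M} (v : TangentSpace 𝓘(ℝ, E) p) :
    ∃ X : Π q : M, TangentSpace 𝓘(ℝ, E) q, CMDiff ∞ (T% X) ∧
      ∀ᶠ q in 𝓝 p, X q = FiberBundle.extend E v q := by
  obtain ⟨s, hs, hX⟩ := FiberBundle.exists_contMDiffOn_extend (k := ∞) 𝓘(ℝ, E) E v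
  obtain ⟨ψ, -, hψ⟩ := (SmoothBumpFunction.nhds_basis_tsupport (I := 𝓘(ℝ, E)) p).mem_iff.1
    (interior_mem_nhds.2 hs)
  refine ⟨(ψ : M → ℝ) • FiberBundle.extend E v, ?_, ?_⟩
  · exact ContMDiffOn.smul_section_of_tsupport (u := interior s) ψ.contMDiff.contMDiffOn
      isOpen_interior hψ (hX.mono interior_subset)
  · filter_upwards [ψ.eventuallyEq_one] with q hq
    simp [hq]

theorem exists_smooth_vectorField {p : M} (v : TangentSpace 𝓘(ℝ, E) p) :
    ∃ X : Π q : M, TangentSpace 𝓘(ℝ, E) q, CMDiff ∞ (T% X) ∧ X p = v := by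
  obtain ⟨X, hX, h⟩ := exists_smooth_vectorField_eventuallyEq_extend v
  exact ⟨X, hX, by simpa using h.self_of_nhds⟩

end VectorFields

/-! ### Regularity of covariant derivatives and inner products of vector fields -/

section ConnectionsAndMetrics

variable {E : Type*} [NormedAddCommGroup E] [NormedSpace ℝ E]
  {M : Type*} [TopologicalSpace M] [ChartedSpace E M] [IsManifold 𝓘(ℝ, E) ∞ M]

theorem contMDiff_cov {cov : AffineConnection E M} (h : cov.ContMDiffCovariantDerivative ∞)
    {X Y : Π q : M, TangentSpace 𝓘(ℝ, E) q} (hX : CMDiff ∞ (T% X)) (hY : CMDiff ∞ (T% Y)) :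
    CMDiff ∞ (T% (fun q ↦ cov Y q (X q))) := by
  have h1 := h.contMDiff.contMDiff (σ := Y) (by simpa using hY.contMDiffOn)
  exact (contMDiffOn_univ.1 h1).clm_bundle_apply hX

theorem mdifferentiableAt_inner (g : SmoothMetric E M) {p : M}
    {X Y : Π q : M, TangentSpace 𝓘(ℝ, E) q} (hX : MDiffAt (T% X) p) (hY : MDiffAt (T% Y) p) :
    MDiffAt (fun q ↦ g.inner q (X q) (Y q)) p := by
  have h : MDifferentiableAt 𝓘(ℝ, E) (𝓘(ℝ, E).prod 𝓘(ℝ))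
      (fun q ↦ TotalSpace.mk' ℝ (E := Bundle.Trivial M ℝ) q (g.inner q (X q) (Y q))) p :=
    MDifferentiableAt.clm_bundle_apply₂ (F₁ := E) (F₂ := E)
      ((g.contMDiff p).mdifferentiableAt (by simp)) hX hY
  simp only [mdifferentiableAt_totalSpace] at h
  exact h.2

end ConnectionsAndMetrics

/-! ### The difference tensor of a statistical connection and the Levi-Civita connection -/

section Difference

variable {E : Type*} [NormedAddCommGroup E] [NormedSpace ℝ E] [FiniteDimensional ℝ E]
  {M : Type*} [TopologicalSpace M] [ChartedSpace E M] [IsManifold 𝓘(ℝ, E) ∞ M]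

theorem difference_apply_section (cov cov₀ : AffineConnection E M) {p : M}
    {Y : Π q : M, TangentSpace 𝓘(ℝ, E) q} (hY : MDiffAt (T% Y) p) :
    cov.difference cov₀ p (Y p) = cov Y p - cov₀ Y p :=
  IsCovariantDerivativeOn.difference_apply _ _ (by trivial) hY

/-- The difference tensor of two torsion-free connections is symmetric. -/
theorem difference_symm {cov cov₀ : AffineConnection E M} (h : cov.torsion = 0)
    (h₀ : cov₀.torsion = 0) (p : M) (u v : TangentSpace 𝓘(ℝ, E) p) :
    cov.difference cov₀ p u v = cov.difference cov₀ p v u := by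
  have hu := FiberBundle.mdifferentiableAt_extend 𝓘(ℝ, E) E u
  have hv := FiberBundle.mdifferentiableAt_extend 𝓘(ℝ, E) E v
  have h1 := cov.torsion_eq_zero_iff.1 h hu hv
  have h2 := cov₀.torsion_eq_zero_iff.1 h₀ hu hv
  have h3 := difference_apply_section cov cov₀ hu
  have h4 := difference_apply_section cov cov₀ hv
  simp only [FiberBundle.extend_apply_self] at h1 h2 h3 h4
  rw [h3, h4, sub_apply, sub_apply]
  rw [← h2] at h1
  rw [sub_eq_sub_iff_sub_eq_sub, ← neg_inj, neg_sub, neg_sub, h1]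

variable [T2Space M]

/-- The Codazzi equation makes the cubic form `(u, v, w) ↦ g(K_v u, w)` of the difference tensor `K` of
`∇` and the Levi-Civita connection symmetric in `u` and `w`; together with `difference_symm` it is
totally symmetric. In other words each `K_v` is self-adjoint. -/
theorem inner_difference_comm {cov cov₀ : AffineConnection E M} {g : SmoothMetric E M}
    (h : IsStatisticalStructure cov g) (h₀ : IsLeviCivita cov₀ g)
    (p : M) (u v w : TangentSpace 𝓘(ℝ, E) p) :
    g.inner p (cov.difference cov₀ p u v) w = g.inner p (cov.difference cov₀ p w v) u := by
  obtain ⟨X, hX, rfl⟩ := exists_smooth_vectorField u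
  obtain ⟨Y, hY, rfl⟩ := exists_smooth_vectorField v
  obtain ⟨Z, hZ, rfl⟩ := exists_smooth_vectorField w
  have hd {X : Π q : M, TangentSpace 𝓘(ℝ, E) q} (hX : CMDiff ∞ (T% X)) : MDiffAt (T% X) p :=
    (hX p).mdifferentiableAt (by simp)
  have key {X Y Z : Π q : M, TangentSpace 𝓘(ℝ, E) q} (hX : CMDiff ∞ (T% X)) (hY : CMDiff ∞ (T% Y))
      (hZ : CMDiff ∞ (T% Z)) : covDerivMetric cov g X Y Z p =
      - g.inner p (cov.difference cov₀ p (Y p) (X p)) (Z p)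
      - g.inner p (cov.difference cov₀ p (Z p) (X p)) (Y p) := by
    have := h₀.metric X Y Z hX hY hZ p
    rw [difference_apply_section _ _ (hd hY), difference_apply_section _ _ (hd hZ)]
    simp only [covDerivMetric, sub_apply, map_sub] at this ⊢
    rw [g.symm p (Y p) (cov Z p (X p))]
    rw [g.symm p (Y p) (cov₀ Z p (X p))] at this
    linarith
  have hs := difference_symm h.torsion_eq_zero h₀.torsion_eq_zero p
  have h1 := h.codazzi X Z Y hX hZ hY p
  rw [key hX hZ hY, key hZ hX hY, hs (Z p) (X p)] at h1
  rw [hs (X p), hs (Z p)]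
  rw [hs (Y p), hs (Y p)] at h1
  rw [hs (Y p) (X p), hs (Y p) (Z p)]
  linarith

/-- If both `∇ = ∇° + K` and the Levi-Civita connection `∇°` have constant curvature, then
`g([K_x, K_y] z, w) = (k - k₀) (g(y, z) g(x, w) - g(x, z) g(y, w))`. The difference of the curvatures
is `(∇°_x K)_y - (∇°_y K)_x + [K_x, K_y]`. Its first part is self-adjoint, while the commutator and
both curvatures are skew-adjoint, so antisymmetrizing in `z` and `w` leaves only the commutator. Since
`K_x` and `K_y` are self-adjoint, the commutator appears as
`g(K_y z, K_x w) - g(K_x z, K_y w)`. -/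
theorem inner_difference_bracket {cov cov₀ : AffineConnection E M} {g : SmoothMetric E M}
    (h : IsStatisticalStructure cov g) (h₀ : IsLeviCivita cov₀ g) {k k₀ : ℝ}
    (hk : HasConstantCurvature cov g k) (hk₀ : HasConstantCurvature cov₀ g k₀)
    (p : M) (x y z w : TangentSpace 𝓘(ℝ, E) p) :
    g.inner p (cov.difference cov₀ p z y) (cov.difference cov₀ p w x)
        - g.inner p (cov.difference cov₀ p z x) (cov.difference cov₀ p w y)
      = (k - k₀) * (g.inner p y z * g.inner p x w - g.inner p x z * g.inner p y w) := by
  obtain ⟨X, hX, rfl⟩ := exists_smooth_vectorField x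
  obtain ⟨Y, hY, rfl⟩ := exists_smooth_vectorField y
  obtain ⟨Z, hZ, rfl⟩ := exists_smooth_vectorField z
  obtain ⟨W, hW, rfl⟩ := exists_smooth_vectorField w
  have hd {X : Π q : M, TangentSpace 𝓘(ℝ, E) q} (hX : CMDiff ∞ (T% X)) (p : M) : MDiffAt (T% X) p :=
    (hX p).mdifferentiableAt (by simp)
  set D := cov.difference cov₀ with hD
  have hc := inner_difference_comm h h₀
  rw [← hD] at hc
  -- `∇_X (∇_Y Z)` in terms of `∇°` and `D`; metricity of `∇°` moves the derivative of `D` onto the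
  -- cubic form, whose symmetry in `Z` and `W` is known
  have key {X Y Z W : Π q : M, TangentSpace 𝓘(ℝ, E) q} (hX : CMDiff ∞ (T% X))
      (hY : CMDiff ∞ (T% Y)) (hZ : CMDiff ∞ (T% Z)) (hW : CMDiff ∞ (T% W)) :
      g.inner p (cov (fun q ↦ cov Z q (Y q)) p (X p)) (W p)
        - g.inner p (cov₀ (fun q ↦ cov₀ Z q (Y q)) p (X p)) (W p)
      = mvfderiv 𝓘(ℝ, E) (fun q ↦ g.inner q (D q (Z q) (Y q)) (W q)) p (X p)
        - g.inner p (D p (Z p) (Y p)) (cov₀ W p (X p))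
        + g.inner p (D p (cov₀ Z p (Y p)) (X p)) (W p)
        + g.inner p (D p (Z p) (Y p)) (D p (W p) (X p)) := by
    have hN := contMDiff_cov h₀.smooth hY hZ
    have hK : CMDiff ∞ (T% (fun q ↦ D q (Z q) (Y q))) := by
      have := (contMDiff_cov h.smooth hY hZ).sub_section hN
      refine this.congr fun q ↦ ?_
      rw [hD, difference_apply_section _ _ (hd hZ q)]
      rfl
    have h1 : (fun q ↦ cov Z q (Y q)) = (fun q ↦ cov₀ Z q (Y q)) + (fun q ↦ D q (Z q) (Y q)) := by
      funext q
      rw [Pi.add_apply, hD, difference_apply_section _ _ (hd hZ q)]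
      simp
    have h2 := cov.isCovariantDerivativeOn.add (s := Set.univ) (hd hN p) (hd hK p)
    rw [h1, h2]
    have h3 := difference_apply_section cov cov₀ (hd hN p)
    have h4 := difference_apply_section cov cov₀ (hd hK p)
    have h5 := h₀.metric X _ W hX hK hW p
    rw [← hD] at h3 h4
    rw [eq_comm, sub_eq_iff_eq_add] at h3 h4
    rw [h3, h4]
    have h6 := hc p (D p (Z p) (Y p)) (X p) (W p)
    simp only [covDerivMetric] at h5
    simp only [add_apply, map_add, h6]
    rw [g.symm p (D p (W p) (X p))]
    linarith
  -- the four curvature equations to be antisymmetrized in `Z` and `W`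
  have e1 := hk X Y Z hX hY hZ p
  have e2 := hk X Y W hX hY hW p
  have e3 := hk₀ X Y Z hX hY hZ p
  have e4 := hk₀ X Y W hX hY hW p
  apply_fun (fun a ↦ g.inner p a (W p)) at e1 e3
  apply_fun (fun a ↦ g.inner p a (Z p)) at e2 e4
  simp only [affineCurvature, map_sub, sub_apply, map_smul,
    _root_.smul_apply, smul_eq_mul] at e1 e2 e3 e4
  have b1 := key hX hY hZ hW
  have b2 := key hY hX hZ hW
  have b3 := key hX hY hW hZ
  have b4 := key hY hX hW hZ
  have c1 := difference_apply_section cov cov₀ (hd hZ p)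
  have c2 := difference_apply_section cov cov₀ (hd hW p)
  rw [← hD, eq_comm, sub_eq_iff_eq_add] at c1 c2
  rw [c1] at e1
  rw [c2] at e2
  simp only [add_apply, map_add] at e1 e2
  -- the remaining symmetries: of the cubic form, as functions and at `p`, and of the metric
  have f1 : (fun q ↦ g.inner q (D q (Z q) (Y q)) (W q)) =
    (fun q ↦ g.inner q (D q (W q) (Y q)) (Z q)) := funext fun q ↦ hc _ _ _ _
  have f2 : (fun q ↦ g.inner q (D q (Z q) (X q)) (W q)) =
    (fun q ↦ g.inner q (D q (W q) (X q)) (Z q)) := funext fun q ↦ hc _ _ _ _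
  rw [f1] at b1
  rw [f2] at b2
  have d1 := hc p (Z p) (VectorField.mlieBracket 𝓘(ℝ, E) X Y p) (W p)
  have d2 := hc p (cov₀ Z p (Y p)) (X p) (W p)
  have d3 := hc p (cov₀ Z p (X p)) (Y p) (W p)
  have d4 := hc p (cov₀ W p (Y p)) (X p) (Z p)
  have d5 := hc p (cov₀ W p (X p)) (Y p) (Z p)
  have s1 := g.symm p (D p (W p) (Y p)) (D p (Z p) (X p))
  have s2 := g.symm p (D p (W p) (X p)) (D p (Z p) (Y p))
  have t1 := g.symm p (D p (W p) (X p)) (cov₀ Z p (Y p))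
  have t2 := g.symm p (D p (W p) (Y p)) (cov₀ Z p (X p))
  have t3 := g.symm p (D p (Z p) (X p)) (cov₀ W p (Y p))
  have t4 := g.symm p (D p (Z p) (Y p)) (cov₀ W p (X p))
  have s3 := g.symm p (X p) (W p)
  have s4 := g.symm p (Y p) (W p)
  have s5 := g.symm p (X p) (Z p)
  have s6 := g.symm p (Y p) (Z p)
  rw [s3, s4] at e1 e2 e3 e4
  rw [s5, s6] at e1 e2 e3 e4
  rw [s3, s4, s5, s6]
  linarith

end Difference

/-! ### Covariant derivatives along a map -/

section AlongMaps

variable {E' : Type*} [NormedAddCommGroup E'] [NormedSpace ℝ E']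
  {M' : Type*} [TopologicalSpace M'] [ChartedSpace E' M'] [IsManifold 𝓘(ℝ, E') ∞ M']

/-- The local vector field around `y` with constant components `a` in the standard trivialization of
`TM'` at `y`, extended by zero. -/
def frameField (y : M') (a : E') (z : M') : TangentSpace 𝓘(ℝ, E') z :=
  (trivializationAt E' (TangentSpace 𝓘(ℝ, E') : M' → Type _) y).symmL ℝ z a

theorem frameField_apply {y z : M'}
    (hz : z ∈ (trivializationAt E' (TangentSpace 𝓘(ℝ, E') : M' → Type _) y).baseSet)
    (v : TangentSpace 𝓘(ℝ, E') z) :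
    frameField y (trivializationAt E' (TangentSpace 𝓘(ℝ, E') : M' → Type _) y ⟨z, v⟩).2 z = v := by
  rw [frameField, Trivialization.symmL_apply _ hz, Trivialization.symm_apply_apply_mk _ hz]

/-- `FiberBundle.extend` has unspecified values off the base set of the trivialization, hence is linear
in the vector only locally; `frameField` is linear everywhere. -/
theorem extend_eventuallyEq_frameField {y : M'} (v : TangentSpace 𝓘(ℝ, E') y) :
    ∀ᶠ z in 𝓝 y, FiberBundle.extend E' v z =
      frameField y (trivializationAt E' (TangentSpace 𝓘(ℝ, E') : M' → Type _) y ⟨y, v⟩).2 z := by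
  filter_upwards [(trivializationAt E' (TangentSpace 𝓘(ℝ, E') : M' → Type _) y).open_baseSet.mem_nhds
    (FiberBundle.mem_baseSet_trivializationAt' y)] with z hz
  rw [frameField, Trivialization.symmL_apply _ hz]
  rfl

theorem extend_frameField_eventuallyEq (y : M') (a : E') :
    ∀ᶠ z in 𝓝 y, FiberBundle.extend E' (frameField y a y) z = frameField y a z := by
  have hy : y ∈ (trivializationAt E' (TangentSpace 𝓘(ℝ, E') : M' → Type _) y).baseSet :=
    FiberBundle.mem_baseSet_trivializationAt' y
  have h := extend_eventuallyEq_frameField (frameField y a y)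
  have ha : (trivializationAt E' (TangentSpace 𝓘(ℝ, E') : M' → Type _) y
      ⟨y, frameField y a y⟩).2 = a := by
    rw [frameField, Trivialization.symmL_apply _ hy, Trivialization.apply_mk_symm _ hy]
  rwa [ha] at h

theorem mdifferentiableAt_frameField (y : M') (a : E') : MDiffAt (T% (frameField y a)) y := by
  refine (FiberBundle.mdifferentiableAt_extend 𝓘(ℝ, E') E' (frameField y a y)
    ).congr_of_eventuallyEq ?_
  filter_upwards [extend_frameField_eventuallyEq y a] with z hz
  rw [hz]

variable [FiniteDimensional ℝ E']

theorem mvfderiv_inner_frameField [T2Space M'] {cov : AffineConnection E' M'}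
    {g : SmoothMetric E' M'} (h : IsLeviCivita cov g) {y : M'} (a b : E')
    (u : TangentSpace 𝓘(ℝ, E') y) :
    mvfderiv 𝓘(ℝ, E') (fun z ↦ g.inner z (frameField y a z) (frameField y b z)) y u
      = g.inner y (cov (frameField y a) y u) (frameField y b y)
        + g.inner y (frameField y a y) (cov (frameField y b) y u) := by
  have key (a : E') : ∃ A : Π q : M', TangentSpace 𝓘(ℝ, E') q, CMDiff ∞ (T% A) ∧
      (∀ᶠ z in 𝓝 y, A z = frameField y a z) ∧ cov A y = cov (frameField y a) y := by
    obtain ⟨A, hA, hA'⟩ := exists_smooth_vectorField_eventuallyEq_extend (frameField y a y)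
    have h1 : ∀ᶠ z in 𝓝 y, A z = frameField y a z := by
      filter_upwards [hA', extend_frameField_eventuallyEq y a] with z h1 h2
      rw [h1, h2]
    exact ⟨A, hA, h1, cov.isCovariantDerivativeOn.congr_of_eventuallyEq (s := Set.univ)
      ((hA y).mdifferentiableAt (by simp)) (mdifferentiableAt_frameField y a) univ_mem h1⟩
  obtain ⟨A, hA, hA', cA⟩ := key a
  obtain ⟨B, hB, hB', cB⟩ := key b
  obtain ⟨X, hX, rfl⟩ := exists_smooth_vectorField u
  have h1 := h.metric X A B hX hA hB y
  have hAB : (fun z ↦ g.inner z (A z) (B z)) =ᶠ[𝓝 y]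
      fun z ↦ g.inner z (frameField y a z) (frameField y b z) := by
    filter_upwards [hA', hB'] with z h1 h2
    rw [h1, h2]
  have hm : mvfderiv 𝓘(ℝ, E') (fun z ↦ g.inner z (A z) (B z)) y (X y) = mvfderiv 𝓘(ℝ, E')
      (fun z ↦ g.inner z (frameField y a z) (frameField y b z)) y (X y) := by
    unfold mvfderiv
    simp only [ContinuousLinearMap.comp_apply]
    rw [hAB.mfderiv_eq]
    rfl
  simp only [covDerivMetric, cA, cB, hA'.self_of_nhds, hB'.self_of_nhds, hm] at h1
  linarith

/-- The connection form at `y` in the standard trivialization: the derivative at `y` of the field with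
constant components `a`, as a linear function of `a`. -/
def frameConnection (cov : AffineConnection E' M') (y : M') :
    E' →ₗ[ℝ] TangentSpace 𝓘(ℝ, E') y →L[ℝ] TangentSpace 𝓘(ℝ, E') y :=
  { toFun a := cov (frameField y a) y
    map_add' a b := by
      have : frameField y (a + b) = frameField y a + frameField y b := by
        funext z; simp [frameField]
      rw [this]
      exact cov.isCovariantDerivativeOn.add (s := Set.univ) (mdifferentiableAt_frameField y a)
        (mdifferentiableAt_frameField y b)
    map_smul' c a := by
      have : frameField y (c • a) = c • frameField y a := by
        funext z; simp [frameField]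
      rw [this]
      exact cov.isCovariantDerivativeOn.smul_const (s := Set.univ) c
        (mdifferentiableAt_frameField y a) }

variable {E : Type*} [NormedAddCommGroup E] [NormedSpace ℝ E]
  {M : Type*} [TopologicalSpace M] [ChartedSpace E M]

/-- Covariant derivatives along `f` for two connections differ by the difference tensor. -/
theorem covDerivAlong_sub (cov cov₀ : AffineConnection E' M') (f : M → M')
    (V : Π p : M, TangentSpace 𝓘(ℝ, E') (f p)) (p : M) (v : TangentSpace 𝓘(ℝ, E) p) :
    covDerivAlong cov f V p v = covDerivAlong cov₀ f V p v
      + cov.difference cov₀ (f p) (V p) (mfderiv 𝓘(ℝ, E) 𝓘(ℝ, E') f p v) := by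
  have h := difference_apply_section cov cov₀ (p := f p)
    (FiberBundle.mdifferentiableAt_extend 𝓘(ℝ, E') E' (V p))
  simp only [FiberBundle.extend_apply_self] at h
  rw [h]
  simp only [covDerivAlong, add_apply, sub_apply, ContinuousLinearMap.comp_apply]
  abel

/-- The connection that a Levi-Civita connection induces along `f` is metric:
`v ⟨V, W⟩ = ⟨∇_v V, W⟩ + ⟨V, ∇_v W⟩`. In a local frame `s_i` around `f p` the inner product is
`∑ V^i W^j (g(s_i, s_j) ∘ f)`, to which the product rule and `mvfderiv_inner_frameField` apply. -/
theorem mvfderiv_inner_along [T2Space M'] {cov : AffineConnection E' M'} {g : SmoothMetric E' M'}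
    (h : IsLeviCivita cov g) {f : M → M'} {V W : Π p : M, TangentSpace 𝓘(ℝ, E') (f p)} {p : M}
    (hV : MDifferentiableAt 𝓘(ℝ, E) 𝓘(ℝ, E').tangent
      (fun q ↦ (⟨f q, V q⟩ : TangentBundle 𝓘(ℝ, E') M')) p)
    (hW : MDifferentiableAt 𝓘(ℝ, E) 𝓘(ℝ, E').tangent
      (fun q ↦ (⟨f q, W q⟩ : TangentBundle 𝓘(ℝ, E') M')) p)
    (v : TangentSpace 𝓘(ℝ, E) p) :
    mvfderiv 𝓘(ℝ, E) (fun q ↦ g.inner (f q) (V q) (W q)) p v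
      = g.inner (f p) (covDerivAlong cov f V p v) (W p)
        + g.inner (f p) (V p) (covDerivAlong cov f W p v) := by
  set t := trivializationAt E' (TangentSpace 𝓘(ℝ, E') : M' → Type _) (f p)
  have hp : f p ∈ t.baseSet := FiberBundle.mem_baseSet_trivializationAt' (f p)
  set S : E' → Π y : M', TangentSpace 𝓘(ℝ, E') y := frameField (f p) with hS
  obtain ⟨hf, hφ⟩ := (mdifferentiableAt_totalSpace _ _).1 hV
  obtain ⟨-, hψ⟩ := (mdifferentiableAt_totalSpace _ _).1 hW
  simp only at hf hφ hψ
  set φ : M → E' := fun q ↦ (t ⟨f q, V q⟩).2 with hφd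
  set ψ : M → E' := fun q ↦ (t ⟨f q, W q⟩).2 with hψd
  have hSV {V : Π p : M, TangentSpace 𝓘(ℝ, E') (f p)} {q : M} (hq : f q ∈ t.baseSet) :
      S (t ⟨f q, V q⟩).2 (f q) = V q :=
    frameField_apply hq _
  set b := Module.finBasis ℝ E'
  set Γ := frameConnection cov (f p)
  set u := mfderiv 𝓘(ℝ, E) 𝓘(ℝ, E') f p v
  have hH (a c : E') : MDiffAt (fun y ↦ g.inner y (S a y) (S c y)) (f p) :=
    mdifferentiableAt_inner g (mdifferentiableAt_frameField _ a)
      (mdifferentiableAt_frameField _ c)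
  have hdH (a c : E') : mvfderiv 𝓘(ℝ, E') (fun y ↦ g.inner y (S a y) (S c y)) (f p) u
      = g.inner (f p) (Γ a u) (S c (f p)) + g.inner (f p) (S a (f p)) (Γ c u) :=
    mvfderiv_inner_frameField h a c u
  -- expansion of a bilinear form in the basis `b`
  have bil (B : E' →ₗ[ℝ] E' →ₗ[ℝ] ℝ) (a c : E') :
      B a c = ∑ i, ∑ j, b.repr a i * b.repr c j * B (b i) (b j) := by
    conv_lhs => rw [← b.sum_repr a, ← b.sum_repr c]
    simp only [map_sum, map_smul, LinearMap.sum_apply, LinearMap.smul_apply, smul_eq_mul,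
      Finset.mul_sum, mul_assoc]
    rw [Finset.sum_comm]
    refine Finset.sum_congr rfl fun i _ ↦ Finset.sum_congr rfl fun j _ ↦ by ring
  have bilS (y : M') (a c : E') : g.inner y (S a y) (S c y)
      = ∑ i, ∑ j, b.repr a i * b.repr c j * g.inner y (S (b i) y) (S (b j) y) :=
    bil (LinearMap.mk₂ ℝ (fun a c ↦ g.inner y (S a y) (S c y)) (by simp [hS, frameField])
      (by simp [hS, frameField]) (by simp [hS, frameField]) (by simp [hS, frameField])) a c
  have bilΓ (a c : E') :
      g.inner (f p) (Γ a u) (S c (f p)) + g.inner (f p) (S a (f p)) (Γ c u)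
      = ∑ i, ∑ j, b.repr a i * b.repr c j *
        mvfderiv 𝓘(ℝ, E') (fun y ↦ g.inner y (S (b i) y) (S (b j) y)) (f p) u := by
    simp only [hdH]
    refine bil (LinearMap.mk₂ ℝ (fun a c ↦ g.inner (f p) (Γ a u) (S c (f p))
      + g.inner (f p) (S a (f p)) (Γ c u)) ?_ ?_ ?_ ?_) a c
    · intros; simp [hS, frameField]; ring
    · intros; simp [hS, frameField]; ring
    · intros; simp [hS, frameField]; ring
    · intros; simp [hS, frameField]; ring
  have hco {φ : M → E'} (hφ : MDiffAt φ p) (i) : HasMFDerivAt 𝓘(ℝ, E) 𝓘(ℝ, ℝ)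
      (fun q ↦ b.repr (φ q) i) p
      ((b.coord i).toContinuousLinearMap ∘L mvfderiv 𝓘(ℝ, E) φ p) := by
    have h1 := ((b.coord i).toContinuousLinearMap).hasMFDerivAt (x := φ p)
    exact h1.comp p hφ.hasMFDerivAt
  have hHf (i j) : HasMFDerivAt 𝓘(ℝ, E) 𝓘(ℝ, ℝ)
      (fun q ↦ g.inner (f q) (S (b i) (f q)) (S (b j) (f q))) p
      (mvfderiv 𝓘(ℝ, E') (fun y ↦ g.inner y (S (b i) y) (S (b j) y)) (f p)
        ∘L mfderiv 𝓘(ℝ, E) 𝓘(ℝ, E') f p) :=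
    (hH (b i) (b j)).hasMFDerivAt.comp p hf.hasMFDerivAt
  have hsum := HasMFDerivAt.sum (t := Finset.univ) fun i _ ↦
    HasMFDerivAt.sum (t := Finset.univ) fun j _ ↦ ((hco hφ i).mul (hco hψ j)).mul (hHf i j)
  have hev : (fun q ↦ g.inner (f q) (V q) (W q)) =ᶠ[𝓝 p]
      ∑ i, ∑ j, (fun q ↦ b.repr (φ q) i) * (fun q ↦ b.repr (ψ q) j)
        * (fun q ↦ g.inner (f q) (S (b i) (f q)) (S (b j) (f q))) := by
    filter_upwards [hf.continuousAt.preimage_mem_nhds (t.open_baseSet.mem_nhds hp)] with q hq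
    simp only [Finset.sum_apply, Pi.mul_apply]
    rw [← bilS, hφd, hψd]
    simp only []
    rw [hSV hq, hSV hq]
  have hder : mvfderiv 𝓘(ℝ, E) (fun q ↦ g.inner (f q) (V q) (W q)) p
      = ∑ i, ∑ j, ((b.repr (φ p) i * b.repr (ψ p) j) •
            (mvfderiv 𝓘(ℝ, E') (fun y ↦ g.inner y (S (b i) y) (S (b j) y)) (f p)
              ∘L mfderiv 𝓘(ℝ, E) 𝓘(ℝ, E') f p)
          + g.inner (f p) (S (b i) (f p)) (S (b j) (f p)) •
            (b.repr (φ p) i • ((b.coord j).toContinuousLinearMap ∘L mvfderiv 𝓘(ℝ, E) ψ p)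
              + b.repr (ψ p) j • ((b.coord i).toContinuousLinearMap ∘L mvfderiv 𝓘(ℝ, E) φ p))) :=
    (hsum.congr_of_eventuallyEq hev).mfderiv
  have hcd {V : Π p : M, TangentSpace 𝓘(ℝ, E') (f p)} : covDerivAlong cov f V p v
      = S (mvfderiv 𝓘(ℝ, E) (fun q ↦ (t ⟨f q, V q⟩).2) p v) (f p) + Γ (t ⟨f p, V p⟩).2 u := by
    have := cov.isCovariantDerivativeOn.congr_of_eventuallyEq (s := Set.univ)
      (FiberBundle.mdifferentiableAt_extend 𝓘(ℝ, E') E' (V p)) (mdifferentiableAt_frameField _ _)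
      univ_mem (extend_eventuallyEq_frameField (V p))
    simp only [covDerivAlong, this, add_apply, ContinuousLinearMap.comp_apply]
    rfl
  rw [hcd, hcd]
  conv_rhs => rw [← hSV (V := V) hp, ← hSV (V := W) hp]
  simp only [map_add, add_apply, hSV hp]
  -- the three groups of terms in the product rule, expanded in the frame
  have e1 := bilS (f p) (mvfderiv 𝓘(ℝ, E) φ p v) (ψ p)
  have e2 := bilS (f p) (φ p) (mvfderiv 𝓘(ℝ, E) ψ p v)
  have e3 := bilΓ (φ p) (ψ p)
  have hV' : S (φ p) (f p) = V p := hSV hp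
  have hW' : S (ψ p) (f p) = W p := hSV hp
  rw [hV'] at e2 e3
  rw [hW'] at e1 e3
  trans (g.inner (f p) (S (mvfderiv 𝓘(ℝ, E) φ p v) (f p)) (W p)
      + g.inner (f p) (V p) (S (mvfderiv 𝓘(ℝ, E) ψ p v) (f p)))
      + (g.inner (f p) (Γ (φ p) u) (W p) + g.inner (f p) (V p) (Γ (ψ p) u))
  · rw [hder, e1, e2, e3]
    simp only [← Finset.sum_add_distrib, sum_apply, add_apply, _root_.smul_apply, smul_eq_mul,
      ContinuousLinearMap.comp_apply, LinearMap.coe_toContinuousLinearMap', Module.Basis.coord_apply]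
    refine Finset.sum_congr rfl fun i _ ↦ Finset.sum_congr rfl fun j _ ↦ ?_
    ring
  · ring

end AlongMaps

/-! ### Linear algebra of the Gauss and Codazzi equations -/

section Algebra

variable {T T' : Type*} [AddCommGroup T] [Module ℝ T] [TopologicalSpace T]
  [AddCommGroup T'] [Module ℝ T'] [TopologicalSpace T']

/-- In codimension one, a vector orthogonal to the tangent space is a multiple of the unit normal. -/
theorem eq_smul_unitNormal [FiniteDimensional ℝ T] [FiniteDimensional ℝ T']
    (g : T' →L[ℝ] T' →L[ℝ] ℝ) (hpos : ∀ v, v ≠ 0 → 0 < g v v)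
    (hdim : Module.finrank ℝ T' = Module.finrank ℝ T + 1) (L : T →L[ℝ] T')
    (hL : Function.Injective L) {ξ : T'} (hunit : g ξ ξ = 1) (hnormal : ∀ v, g ξ (L v) = 0)
    {a : T'} (ha : ∀ v, g a (L v) = 0) : a = g a ξ • ξ := by
  let Φ : T × ℝ →ₗ[ℝ] T' := L.toLinearMap.coprod (LinearMap.toSpanSingleton ℝ T' ξ)
  have hΦ (z : T × ℝ) : Φ z = L z.1 + z.2 • ξ := by simp [Φ]
  have hinj : Function.Injective Φ := by
    rw [injective_iff_map_eq_zero]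
    rintro ⟨v, t⟩ hz
    rw [hΦ] at hz
    have ht := congrArg (g ξ) hz
    simp only [map_add, map_smul, hnormal, hunit, map_zero, smul_eq_mul, mul_one, zero_add] at ht
    subst ht
    simp only [zero_smul, add_zero] at hz
    rw [(injective_iff_map_eq_zero L).1 hL v hz, Prod.mk_zero_zero]
  have hsurj : Function.Surjective Φ :=
    (LinearMap.injective_iff_surjective_of_finrank_eq_finrank (by simp [hdim])).1 hinj
  obtain ⟨⟨v, t⟩, hz⟩ := hsurj (a - g a ξ • ξ)
  rw [hΦ] at hz
  by_contra hne
  have h := hpos _ (sub_ne_zero.2 hne)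
  nth_rw 2 [← hz] at h
  simp [ha, hnormal, hunit, mul_comm] at h

variable [IsTopologicalAddGroup T'] [ContinuousConstSMul ℝ T']

/-- The pointwise core. Let `D u v = K_v u` satisfy `hbracket` with `c ≠ 0`, which for self-adjoint `K`
is the commutator equation `[K_x, K_y] z = c (g(y, z) x - g(x, z) y)` paired with `w`, and let the
tangential part of `K` vanish on the hyperplane `L(T)`, so that `K_x y = h(x, y) ξ` there. Then
`τ(x) = g(ξ, K_x ξ)` vanishes: otherwise the normal part of the commutator equation gives
`h(y, z) τ(x) = h(x, z) τ(y)`, so `h` has rank at most one and its Gauss term is zero, against `c ≠ 0`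
in dimension at least two. -/
theorem normal_component_eq_zero [FiniteDimensional ℝ T] [FiniteDimensional ℝ T']
    (g : T' →L[ℝ] T' →L[ℝ] ℝ) (hsymm : ∀ u v, g u v = g v u) (hpos : ∀ v, v ≠ 0 → 0 < g v v)
    (D : T' →L[ℝ] T' →L[ℝ] T') {c : ℝ} (hc : c ≠ 0)
    (hbracket : ∀ x y z w, g (D z y) (D w x) - g (D z x) (D w y)
      = c * (g y z * g x w - g x z * g y w))
    (hn : 2 ≤ Module.finrank ℝ T) (hdim : Module.finrank ℝ T' = Module.finrank ℝ T + 1)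
    (L : T →L[ℝ] T') (hL : Function.Injective L)
    (htan : ∀ u v w, g (D (L u) (L v)) (L w) = 0)
    {ξ : T'} (hunit : g ξ ξ = 1) (hnormal : ∀ v, g ξ (L v) = 0) (x : T) :
    g ξ (D ξ (L x)) = 0 := by
  by_contra hx
  have hD (u v : T) : D (L u) (L v) = g (D (L u) (L v)) ξ • ξ :=
    eq_smul_unitNormal g hpos hdim L hL hunit hnormal (htan u v)
  set h : T → T → ℝ := fun u v ↦ g (D (L u) (L v)) ξ with hh
  -- the commutator equation paired with the normal `ξ`
  have hcod (y z : T) : h z y * g ξ (D ξ (L x)) = h z x * g ξ (D ξ (L y)) := by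
    have := hbracket (L x) (L y) (L z) ξ
    rw [hD z y, hD z x, hsymm (L x) ξ, hsymm (L y) ξ, hnormal, hnormal] at this
    simp only [map_smul, _root_.smul_apply, smul_eq_mul] at this
    linarith
  -- the commutator equation paired with a tangent vector
  have hgauss (y z w : T) : h z y * h w x - h z x * h w y
      = c * (g (L y) (L z) * g (L x) (L w) - g (L x) (L z) * g (L y) (L w)) := by
    rw [← hbracket, hD z y, hD z x, hD w y, hD w x]
    simp only [map_smul, _root_.smul_apply, smul_eq_mul, hunit, hh]
    ring
  have hzero (y z w : T) :
      g (L y) (L z) * g (L x) (L w) - g (L x) (L z) * g (L y) (L w) = 0 := by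
    have h1 := hgauss y z w
    have h2 : (h z y * h w x - h z x * h w y) * g ξ (D ξ (L x)) = 0 := by
      linear_combination h w x * hcod y z - h z x * hcod y w
    rcases mul_eq_zero.1 h2 with h2 | h2
    · rw [h2] at h1
      exact (mul_eq_zero.1 h1.symm).resolve_left hc
    · exact absurd h2 hx
  -- the plane spanned by `x` and any independent `y` contradicts `hzero`
  have hx0 : x ≠ 0 := by
    rintro rfl
    simp at hx
  have hxx : 0 < g (L x) (L x) := hpos _ ((map_ne_zero_iff L hL).2 hx0)
  obtain ⟨y, hy⟩ : ∃ y : T, ∀ t : ℝ, t • x ≠ y := by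
    by_contra! hcon
    have := finrank_le_one x hcon
    omega
  -- replace `y` by its component orthogonal to `x`
  set t := g (L x) (L y) / g (L x) (L x) with ht
  have hy' : L (y - t • x) ≠ 0 :=
    (map_ne_zero_iff L hL).2 (sub_ne_zero.2 (hy t).symm)
  have horth : g (L x) (L (y - t • x)) = 0 := by
    simp only [map_sub, map_smul, smul_eq_mul, ht]
    field_simp
    ring
  have h3 := hzero (y - t • x) (y - t • x) x
  rw [horth, zero_mul, sub_zero] at h3
  exact (mul_pos (hpos _ hy') hxx).ne' h3

end Algebra

/-! ### Statistical immersions of Riemannian manifolds -/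

section Immersions

variable {E : Type*} [NormedAddCommGroup E] [NormedSpace ℝ E]
  {M : Type*} [TopologicalSpace M] [ChartedSpace E M]
  {E' : Type*} [NormedAddCommGroup E'] [NormedSpace ℝ E'] [FiniteDimensional ℝ E']
  {M' : Type*} [TopologicalSpace M'] [T2Space M'] [ChartedSpace E' M'] [IsManifold 𝓘(ℝ, E') ∞ M']

/-- The form `τ^*` is algebraic in the difference tensor `K`: as `⟨ξ, ξ⟩ = 1`, the Levi-Civita
derivative of `ξ` is tangential, so `τ^*(v) = g̃(ξ, K_v ξ)`. -/
theorem weingartenForm_eq_inner_difference {cov' cov₀' : AffineConnection E' M'}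
    {g' : SmoothMetric E' M'} {f : M → M'} (hLC' : IsLeviCivita cov₀' g') {U : Set M}
    (hU : IsOpen U) {ξ : Π p : M, TangentSpace 𝓘(ℝ, E') (f p)}
    (hξ : IsUnitNormalOn (E := E) g' f U ξ) {p : M} (hp : p ∈ U) (v : TangentSpace 𝓘(ℝ, E) p) :
    weingartenForm cov' g' f ξ p v = g'.inner (f p) (ξ p)
      (cov'.difference cov₀' (f p) (ξ p) (mfderiv 𝓘(ℝ, E) 𝓘(ℝ, E') f p v)) := by
  have hd := (hξ.smooth.contMDiffAt (hU.mem_nhds hp)).mdifferentiableAt (by simp)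
  have h1 := mvfderiv_inner_along hLC' hd hd v
  have h2 : (fun q ↦ g'.inner (f q) (ξ q) (ξ q)) =ᶠ[𝓝 p] fun _ ↦ 1 := by
    filter_upwards [hU.mem_nhds hp] with q hq using hξ.unit q hq
  have h3 : mvfderiv 𝓘(ℝ, E) (fun q ↦ g'.inner (f q) (ξ q) (ξ q)) p v = 0 := by
    rw [mvfderiv, h2.mfderiv_eq, mfderiv_const]
    rfl
  rw [h3, g'.symm (f p) (covDerivAlong cov₀' f ξ p v)] at h1
  simp only [weingartenForm, ContinuousLinearMap.comp_apply, covDerivAlong_sub cov' cov₀', map_add]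
  linarith

variable [FiniteDimensional ℝ E] [T2Space M] [IsManifold 𝓘(ℝ, E) ∞ M]

/-- If the induced connection is the Levi-Civita connection, then the difference tensor has no
tangential part on tangent vectors. Both `∇` and the connection induced by the Levi-Civita connection
of `g̃` are metric, so `g̃(K_v u, w)` is antisymmetric in `u` and `w`; it is also symmetric. -/
theorem inner_difference_mfderiv_eq_zero {cov : AffineConnection E M} {g : SmoothMetric E M}
    {cov' cov₀' : AffineConnection E' M'} {g' : SmoothMetric E' M'} {f : M → M'}
    (hLC : IsLeviCivita cov g) (hstat' : IsStatisticalStructure cov' g')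
    (hLC' : IsLeviCivita cov₀' g') (hf : IsStatisticalImmersion cov g cov' g' f)
    (p : M) (u v w : TangentSpace 𝓘(ℝ, E) p) :
    g'.inner (f p) (cov'.difference cov₀' (f p) (mfderiv 𝓘(ℝ, E) 𝓘(ℝ, E') f p u)
      (mfderiv 𝓘(ℝ, E) 𝓘(ℝ, E') f p v)) (mfderiv 𝓘(ℝ, E) 𝓘(ℝ, E') f p w) = 0 := by
  obtain ⟨X, hX, rfl⟩ := exists_smooth_vectorField u
  obtain ⟨Y, hY, rfl⟩ := exists_smooth_vectorField v
  obtain ⟨Z, hZ, rfl⟩ := exists_smooth_vectorField w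
  have hsm {X : Π q : M, TangentSpace 𝓘(ℝ, E) q} (hX : CMDiff ∞ (T% X)) :
      MDifferentiableAt 𝓘(ℝ, E) 𝓘(ℝ, E').tangent (fun q ↦
        (⟨f q, mfderiv 𝓘(ℝ, E) 𝓘(ℝ, E') f q (X q)⟩ : TangentBundle 𝓘(ℝ, E') M')) p := by
    have h1 := hf.immersion.contMDiff.contMDiff_tangentMap (m := ∞) (by simp)
    exact ((h1.comp hX) p).mdifferentiableAt (by simp)
  have h1 := hf.connection_eq Y X Z hY hX hZ p
  have h2 := hf.connection_eq Y Z X hY hZ hX p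
  have h3 := hLC.metric Y X Z hY hX hZ p
  have h4 := mvfderiv_inner_along hLC' (hsm hX) (hsm hZ) (Y p)
  have h5 : (fun q ↦ g.inner q (X q) (Z q)) = fun q ↦ g'.inner (f q)
      (mfderiv 𝓘(ℝ, E) 𝓘(ℝ, E') f q (X q)) (mfderiv 𝓘(ℝ, E) 𝓘(ℝ, E') f q (Z q)) :=
    funext fun q ↦ hf.metric_eq q _ _
  have h6 := inner_difference_comm hstat' hLC' (f p) (mfderiv 𝓘(ℝ, E) 𝓘(ℝ, E') f p (X p))
    (mfderiv 𝓘(ℝ, E) 𝓘(ℝ, E') f p (Y p)) (mfderiv 𝓘(ℝ, E) 𝓘(ℝ, E') f p (Z p))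
  rw [covDerivAlong_sub cov' cov₀'] at h1 h2
  rw [covDerivMetric, h5, h4, g.symm p (X p) (cov Z p (Y p)), h1, h2] at h3
  rw [g'.symm (f p) (mfderiv 𝓘(ℝ, E) 𝓘(ℝ, E') f p (X p)) (covDerivAlong cov₀' f _ p (Y p))] at h3
  simp only [map_add, add_apply] at h3
  linarith

theorem isEquiaffine_of_curvature_ne (hn : 2 ≤ Module.finrank ℝ E)
    (hdim : Module.finrank ℝ E' = Module.finrank ℝ E + 1)
    {cov : AffineConnection E M} {g : SmoothMetric E M}
    {cov' cov₀' : AffineConnection E' M'} {g' : SmoothMetric E' M'} {k' k₀' : ℝ} {f : M → M'}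
    (hLC : IsLeviCivita cov g) (hstat' : IsStatisticalStructure cov' g')
    (hk' : HasConstantCurvature cov' g' k') (hLC' : IsLeviCivita cov₀' g')
    (hk₀' : HasConstantCurvature cov₀' g' k₀') (hne : k₀' ≠ k')
    (hf : IsStatisticalImmersion cov g cov' g' f) :
    IsEquiaffine (E := E) cov' g' f := by
  intro U ξ hU hξ p hp
  ext v
  rw [weingartenForm_eq_inner_difference (cov₀' := cov₀') hLC' hU hξ hp, zero_apply]
  have : FiniteDimensional ℝ (TangentSpace 𝓘(ℝ, E) p) := inferInstanceAs (FiniteDimensional ℝ E)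
  have : FiniteDimensional ℝ (TangentSpace 𝓘(ℝ, E') (f p)) :=
    inferInstanceAs (FiniteDimensional ℝ E')
  have hinj : Function.Injective (mfderiv 𝓘(ℝ, E) 𝓘(ℝ, E') f p) := by
    rw [injective_iff_map_eq_zero]
    intro a ha
    by_contra ha0
    have h := g.pos p a ha0
    rw [hf.metric_eq, ha] at h
    simp at h
  exact normal_component_eq_zero (g'.inner (f p)) (g'.symm (f p)) (g'.pos (f p))
    (cov'.difference cov₀' (f p)) (sub_ne_zero.2 hne.symm)
    (inner_difference_bracket hstat' hLC' hk' hk₀' (f p)) hn hdim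
    (mfderiv 𝓘(ℝ, E) 𝓘(ℝ, E') f p) hinj
    (inner_difference_mfderiv_eq_zero hLC hstat' hLC' hf p) (hξ.unit p hp) (hξ.normal p hp) v

end Immersions

end

theorem theorem4p1
    (n : ℕ) (hn : 2 ≤ n)
    -- the `n`-dimensional manifold `M` and the `(n + 1)`-dimensional manifold `M'`
    {M : Type*} [TopologicalSpace M] [T2Space M] [SecondCountableTopology M]
    [ChartedSpace (EuclideanSpace ℝ (Fin n)) M] [IsManifold (𝓡 n) ∞ M]
    {M' : Type*} [TopologicalSpace M'] [T2Space M'] [SecondCountableTopology M']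
    [ChartedSpace (EuclideanSpace ℝ (Fin (n + 1))) M'] [IsManifold (𝓡 (n + 1)) ∞ M']
    -- `(M, ∇, g)` is trivial of constant curvature `k`
    (cov : AffineConnection (EuclideanSpace ℝ (Fin n)) M)
    (g : SmoothMetric (EuclideanSpace ℝ (Fin n)) M) (k : ℝ)
    (hLC : IsLeviCivita cov g) (hk : HasConstantCurvature cov g k)
    -- `(M', ∇̃, g̃)` is a statistical manifold of constant curvature `k'`
    (cov' : AffineConnection (EuclideanSpace ℝ (Fin (n + 1))) M')
    (g' : SmoothMetric (EuclideanSpace ℝ (Fin (n + 1))) M') (k' : ℝ)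
    (hstat' : IsStatisticalStructure cov' g') (hk' : HasConstantCurvature cov' g' k')
    -- the Levi-Civita connection of `g̃` has constant curvature `k₀' ≠ k'`
    (cov₀' : AffineConnection (EuclideanSpace ℝ (Fin (n + 1))) M') (k₀' : ℝ)
    (hLC' : IsLeviCivita cov₀' g') (hk₀' : HasConstantCurvature cov₀' g' k₀')
    (hne : k₀' ≠ k')
    (f : M → M') (hf : IsStatisticalImmersion cov g cov' g' f) :
    IsEquiaffine (E := EuclideanSpace ℝ (Fin n)) cov' g' f :=
  isEquiaffine_of_curvature_ne (by simpa using hn) (by simp) hLC hstat' hk' hLC' hk₀' hne hf
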